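/- **Setting (hierarchical sampling).** Let $\mathcal Z$ (data) and $\mathcal W$ (hypotheses) be measurable spaces, let $L\ge 1$ and let $n_1,\dots,n_L\ge 1$ be integers. Consider a rooted tree of depth $L$ in which every node of depth $l-1$ has $n_l$ children; its nodes of depth $l$ are indexed by $i_{1:l}=(i_1,\dots,i_l)$ with $1\le i_k\le n_k$, and it has $N_L=n_1\cdots n_L$ leaves. Put $\mathcal P^0(\mathcal Z)=\mathcal Z$ and let $\mathcal P^{h+1}(\mathcal Z)$ be the space of probability measures on $\mathcal P^h(\mathcal Z)$, with the $\sigma$-algebra generated by the evaluations on measurable sets. Fix a meta-distribution $D\in\mathcal P^{L}(\mathcal Z)$. The random dataset is generated as follows: the nodes $\mu_1^{i_1}\in\mathcal P^{L-1}(\mathcal Z)$ are i.i.d. with law $D$, and, given the nodes of depth $l-1$, the nodes $\mu_l^{i_{1:l}}\in\mathcal P^{L-l}(\mathcal Z)$ are independent with $\mu_l^{i_{1:l}}\sim\mu_{l-1}^{i_{1:l-1}}$. Thus the leaves $\mu_L^{i_{1:L}}\in\mathcal Z$ are the data points. **Single-round algorithm.** Every node $i_{1:l-1}$ of depth $l-1$,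 $1\le l\le L$, carries a Markov kernel (aggregation step) which, given the tuple $W_l^{i_{1:l-1}}=(W_l^{i_{1:l-1},j})_{1\le j\le n_l}$ of the hypotheses of its children, outputs a random hypothesis $W_{l-1}^{i_{1:l-1}}\in\mathcal W$; for $l=L$ the inputs are the data points, $W_L^{i_{1:L}}=\mu_L^{i_{1:L}}$. Different nodes use independent randomness. The output of the algorithm is the hypothesis $W=W_0$ of the root. **Privacy.** For every $1\le l\le L$, each aggregation step $P(\cdot\mid\cdot)$ at a node of depth $l-1$ is $\epsilon_l$-differentially private: $P(S\mid w)\le e^{\epsilon_l}P(S\mid w')$ for every measurable $S\subseteq\mathcal W$ and all input tuples $w,w'$ of length $n_l$ that differ in at most one entry. **Generalization error.** Let $\ell:\mathcal W\times\mathcal Z\to[0,1]$ be a measurable loss. Set $$L(w)=\mathbb E[\ell(w,\mu_L^{\rm test})],\qquad \hat L(w,\mu)=\frac1{N_L}\sum_{i_{1:L}}\ell(w,\mu_L^{i_{1:L}}),$$ where $\mu_L^{\rm test}$ is generated by one chain of samplings $\mu_L^{\rm test}\sim\mu_{L-1}\sim\cdots\sim\mu_1\sim D$. **Theorem.** Under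 these assumptions, $$\mathbb E_{W,\mu}\bigl[L(W)-\hat L(W,\mu)\bigr]\;\le\;2\sum_{l=1}^{L}\sqrt{\min\bigl(\epsilon_l,\ \epsilon_l(e^{\epsilon_l}-1)\bigr)}.$$ -/

import Mathlib

open MeasureTheory ProbabilityTheory Real

universe u v

namespace HierFL

/-- The spaces in which the nodes live, indexed by height above the leaves and bundled with their
σ-algebras: height `0` is the data space, height `h + 1` is the space of probability measures on
the space of height `h`. -/
noncomputable def nodeBundle (Z : Type u) [MeasurableSpace Z] : ℕ → Σ α : Type u, MeasurableSpace α
  | 0 => ⟨Z, inferInstance⟩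
  | h + 1 =>
    letI : MeasurableSpace (nodeBundle Z h).1 := (nodeBundle Z h).2
    ⟨ProbabilityMeasure (nodeBundle Z h).1, inferInstance⟩

/-- `NodeSpace Z h` is `Z` for `h = 0`, `𝒫(Z)` for `h = 1`, `𝒫(𝒫(Z))` for `h = 2`, and so on.
In a tree of depth `L`, a node of depth `l` lives in `NodeSpace Z (L - l)`, and the
meta-distribution, which generates the nodes of depth `1`, lives in `NodeSpace Z L`. -/
def NodeSpace (Z : Type u) [MeasurableSpace Z] (h : ℕ) : Type u := (nodeBundle Z h).1

noncomputable instance instMeasurableSpaceNodeSpace (Z : Type u) [MeasurableSpace Z] (h : ℕ) :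
    MeasurableSpace (NodeSpace Z h) := (nodeBundle Z h).2

/-- A node of positive height, as a probability measure on the space of its children. -/
def NodeSpace.toProb {Z : Type u} [MeasurableSpace Z] {h : ℕ} (μ : NodeSpace Z (h + 1)) :
    ProbabilityMeasure (NodeSpace Z h) := μ

/-- The law of one data point `z = μ_L ∼ μ_{L-1} ∼ ⋯ ∼ μ` generated by a chain of samplings which
starts at the node `μ`. -/
noncomputable def testLaw {Z : Type u} [MeasurableSpace Z] : (h : ℕ) → NodeSpace Z h → Measure Z
  | 0, z => Measure.dirac (show Z from z)
  | h + 1, μ => (μ.toProb : Measure (NodeSpace Z h)).bind (testLaw h)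

/-- The families of data points at the leaves of a subtree of height `h` whose root has depth `d`.
A node of depth `l - 1` has `n l` children. -/
def Leaves (Z : Type u) (n : ℕ → ℕ) : (d h : ℕ) → Type u
  | _, 0 => Z
  | d, h + 1 => Fin (n (d + 1)) → Leaves Z n (d + 1) h

instance instMeasurableSpaceLeaves (Z : Type u) [MeasurableSpace Z] (n : ℕ → ℕ) :
    (d h : ℕ) → MeasurableSpace (Leaves Z n d h)
  | _, 0 => (inferInstance : MeasurableSpace Z)
  | d, h + 1 =>
    letI := instMeasurableSpaceLeaves Z n (d + 1) h
    (inferInstance : MeasurableSpace (Fin (n (d + 1)) → Leaves Z n (d + 1) h))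

/-- The law of the leaves of the random subtree below a given node `μ` of depth `d`: the children
of `μ` are drawn independently from `μ`, and then each of them generates, independently of the
others, the leaves below it in the same way. -/
noncomputable def leafLaw {Z : Type u} [MeasurableSpace Z] (n : ℕ → ℕ) :
    (d h : ℕ) → NodeSpace Z h → Measure (Leaves Z n d h)
  | _, 0, z => Measure.dirac (show Z from z)
  | d, h + 1, μ =>
    (Measure.pi fun _ : Fin (n (d + 1)) =>
      (μ.toProb : Measure (NodeSpace Z h)).bind (leafLaw n (d + 1) h) :
      Measure (Fin (n (d + 1)) → Leaves Z n (d + 1) h))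

/-- The sum of `f` over all the leaves. -/
def leafSum {Z : Type u} {n : ℕ → ℕ} (f : Z → ℝ) : (d h : ℕ) → Leaves Z n d h → ℝ
  | _, 0, z => f z
  | d, h + 1, x => ∑ i, leafSum f (d + 1) h (x i)

/-- Differential privacy of a randomized map `κ` of an `m`-tuple: if two inputs differ in at most
one entry, then every output event changes its probability by a factor of at most `e ^ ε`. -/
def IsDP {X : Type u} {Y : Type v} [MeasurableSpace X] [MeasurableSpace Y] {m : ℕ} (ε : ℝ)
    (κ : Kernel (Fin m → X) Y) : Prop :=
  ∀ x x' : Fin m → X, (∃ i, ∀ j, j ≠ i → x j = x' j) →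
    ∀ S : Set Y, MeasurableSet S → κ x S ≤ ENNReal.ofReal (exp ε) * κ x' S

/-- The aggregation steps of a single-round algorithm on a subtree of height `h ≥ 1` whose root has
depth `d`, one Markov kernel for every non-leaf node. A parent of leaves aggregates data points;
any other non-leaf node aggregates the hypotheses which are sent by its children. -/
inductive Aggregation (Z : Type u) (W : Type v) [MeasurableSpace Z] [MeasurableSpace W]
    (n : ℕ → ℕ) : (d h : ℕ) → Type (max u v)
  | last (d : ℕ) (κ : Kernel (Fin (n (d + 1)) → Z) W) (hκ : IsMarkovKernel κ) :
      Aggregation Z W n d 1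
  | node (d h : ℕ) (κ : Kernel (Fin (n (d + 1)) → W) W) (hκ : IsMarkovKernel κ)
      (children : Fin (n (d + 1)) → Aggregation Z W n (d + 1) (h + 1)) :
      Aggregation Z W n d (h + 2)

/-- The aggregation step at every node of depth `l - 1` is `ε l`-differentially private. -/
def Aggregation.IsPrivate {Z : Type u} {W : Type v} [MeasurableSpace Z] [MeasurableSpace W]
    {n : ℕ → ℕ} (ε : ℕ → ℝ) : {d h : ℕ} → Aggregation Z W n d h → Prop
  | _, _, .last d κ _ => IsDP (ε (d + 1)) κ
  | _, _, .node d _ κ _ children => IsDP (ε (d + 1)) κ ∧ ∀ i, (children i).IsPrivate ε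

/-- The conditional law, given the leaves, of the hypothesis formed at the root of the subtree:
the children of the root form their hypotheses from the disjoint sets of leaves below them, with
independent randomness, and the root aggregates them with fresh randomness. -/
noncomputable def Aggregation.outLaw {Z : Type u} {W : Type v} [MeasurableSpace Z]
    [MeasurableSpace W] {n : ℕ → ℕ} :
    {d h : ℕ} → Aggregation Z W n d h → Leaves Z n d h → Measure W
  | _, _, .last d κ _, x => κ (show Fin (n (d + 1)) → Z from x)
  | _, _, .node d _ κ _ children, x =>
    (Measure.pi fun i : Fin (n (d + 1)) => (children i).outLaw (x i)).bind κ

/-- The population risk of the hypothesis `w`. -/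
noncomputable def popRisk {Z : Type u} {W : Type v} [MeasurableSpace Z] (ℓ : W → Z → ℝ) {L : ℕ}
    (D : NodeSpace Z L) (w : W) : ℝ :=
  ∫ z, ℓ w z ∂(testLaw L D)

/-- The empirical risk of the hypothesis `w`: the mean of the loss over the
`N_L = n 1 * ⋯ * n L` leaves. -/
noncomputable def empRisk {Z : Type u} {W : Type v} (ℓ : W → Z → ℝ) {n : ℕ → ℕ} {L : ℕ}
    (w : W) (x : Leaves Z n 0 L) : ℝ :=
  1 / (∏ l ∈ Finset.Icc 1 L, (n l : ℝ)) * leafSum (ℓ w) 0 L x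

/-- The expected generalization error of a single-round hierarchical algorithm. -/
noncomputable def gen {Z : Type u} {W : Type v} [MeasurableSpace Z] [MeasurableSpace W]
    (ℓ : W → Z → ℝ) {n : ℕ → ℕ} {L : ℕ} (D : NodeSpace Z L) (A : Aggregation Z W n 0 L) : ℝ :=
  ∫ x, ∫ w, (popRisk ℓ D w - empRisk ℓ w x) ∂(A.outLaw x) ∂(leafLaw n 0 L D)

/-! ### The laws above are measurable families of probability measures -/

theorem measurable_measure_pi {α : Type*} {β : Type*} [MeasurableSpace α] [MeasurableSpace β]
    {m : ℕ} (κ : Fin m → α → Measure β) (hκ : ∀ i, Measurable (κ i))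
    (hp : ∀ i a, IsProbabilityMeasure (κ i a)) :
    Measurable fun a => Measure.pi fun i => κ i a := by
  have : ∀ a, IsProbabilityMeasure (Measure.pi fun i => κ i a) := fun a => inferInstance
  refine Measurable.measure_of_isPiSystem_of_isProbabilityMeasure
    generateFrom_pi.symm isPiSystem_pi ?_
  rintro _ ⟨s, hs, rfl⟩
  have hs' : ∀ i, MeasurableSet (s i) := fun i => hs i (Set.mem_univ i)
  simp only [Measure.pi_pi]
  exact Finset.measurable_prod _ fun i _ => (Measure.measurable_coe (hs' i)).comp (hκ i)

theorem measurable_testLaw {Z : Type u} [MeasurableSpace Z] (h : ℕ) :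
    Measurable (testLaw (Z := Z) h) ∧ ∀ μ, IsProbabilityMeasure (testLaw (Z := Z) h μ) := by
  induction h with
  | zero =>
    exact ⟨(Measure.measurable_dirac : Measurable (Measure.dirac : Z → Measure Z)),
      fun z => (inferInstance : IsProbabilityMeasure (Measure.dirac (show Z from z)))⟩
  | succ h ih =>
    refine ⟨(Measure.measurable_bind' ih.1).comp (measurable_subtype_coe :
      Measurable (Subtype.val : ProbabilityMeasure (NodeSpace Z h) → _)), fun μ => ?_⟩
    exact isProbabilityMeasure_bind ih.1.aemeasurable (Filter.Eventually.of_forall ih.2)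

theorem measurable_leafLaw {Z : Type u} [MeasurableSpace Z] (n : ℕ → ℕ) (h : ℕ) : ∀ d : ℕ,
    Measurable (leafLaw (Z := Z) n d h) ∧
      ∀ μ, IsProbabilityMeasure (leafLaw (Z := Z) n d h μ) := by
  induction h with
  | zero =>
    exact fun d => ⟨(Measure.measurable_dirac : Measurable (Measure.dirac : Z → Measure Z)),
      fun z => (inferInstance : IsProbabilityMeasure (Measure.dirac (show Z from z)))⟩
  | succ h ih =>
    intro d
    have hp : ∀ μ : NodeSpace Z (h + 1), IsProbabilityMeasure
        ((μ.toProb : Measure (NodeSpace Z h)).bind (leafLaw n (d + 1) h)) := fun μ =>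
      isProbabilityMeasure_bind (ih (d + 1)).1.aemeasurable
        (Filter.Eventually.of_forall (ih (d + 1)).2)
    have hm : Measurable fun μ : NodeSpace Z (h + 1) =>
        (μ.toProb : Measure (NodeSpace Z h)).bind (leafLaw n (d + 1) h) :=
      (Measure.measurable_bind' (ih (d + 1)).1).comp (measurable_subtype_coe :
        Measurable (Subtype.val : ProbabilityMeasure (NodeSpace Z h) → _))
    refine ⟨measurable_measure_pi _ (fun _ => hm) (fun _ => hp), fun μ => ?_⟩
    have := hp μ
    exact (inferInstance : IsProbabilityMeasure (Measure.pi fun _ : Fin (n (d + 1)) =>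
      (μ.toProb : Measure (NodeSpace Z h)).bind (leafLaw n (d + 1) h)))

theorem Aggregation.measurable_outLaw {Z : Type u} {W : Type v} [MeasurableSpace Z]
    [MeasurableSpace W] {n : ℕ → ℕ} {d h : ℕ} (A : Aggregation Z W n d h) :
    Measurable A.outLaw ∧ ∀ x, IsProbabilityMeasure (A.outLaw x) := by
  induction A with
  | last d κ hκ => exact ⟨κ.measurable, fun x => hκ.isProbabilityMeasure _⟩
  | node d h κ hκ children ih =>
    have hm : ∀ i, Measurable fun x : Fin (n (d + 1)) → Leaves Z n (d + 1) (h + 1) =>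
        (children i).outLaw (x i) := fun i => (ih i).1.comp (measurable_pi_apply i)
    have hp : ∀ i (x : Fin (n (d + 1)) → Leaves Z n (d + 1) (h + 1)),
        IsProbabilityMeasure ((children i).outLaw (x i)) := fun i x => (ih i).2 _
    refine ⟨(Measure.measurable_bind' κ.measurable).comp (measurable_measure_pi _ hm hp),
      fun x => ?_⟩
    have := fun i => hp i x
    exact isProbabilityMeasure_bind (m := Measure.pi fun i => (children i).outLaw (x i))
      κ.measurable.aemeasurable (Filter.Eventually.of_forall fun y => hκ.isProbabilityMeasure y)

end HierFL

namespace HierFL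

/-! The root alone gives the bound. The families of leaves below the children of the root are i.i.d.
blocks, and the algorithm is a randomized map of these blocks. Replacing one block changes the law
of one child's hypothesis only, so privacy of the root step makes this map `ε 1`-private in the
blocks (`IsDP.bind_pi_le`).

For a private map of an i.i.d. sample, exchange a sample point with a fresh one: the two expected
losses differ by at most `1 - exp (-ε)` (`integral_gap_le`). Apply this to the mean loss over a
block, whose expectation is the population risk. Finally `1 - exp (-ε)` is below the first summand
of the claim, and the other summands are nonnegative. -/

/-! ### Resampling and privacy under random inputs -/

/-- Resampling one coordinate of a product measure from another law. -/
theorem pi_eq_map_update {ι : Type*} [Fintype ι] [DecidableEq ι] {X : Type*}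
    [MeasurableSpace X] (μ μ' : ι → Measure X) [∀ j, IsProbabilityMeasure (μ j)]
    [∀ j, IsProbabilityMeasure (μ' j)] (i : ι) (h : ∀ j, j ≠ i → μ j = μ' j) :
    Measure.pi μ' =
      ((Measure.pi μ).prod (μ' i)).map fun p : (ι → X) × X => Function.update p.1 i p.2 := by
  have hm : Measurable fun p : (ι → X) × X => Function.update p.1 i p.2 := measurable_update'
  refine Measure.pi_eq fun s hs => ?_
  rw [Measure.map_apply hm (MeasurableSet.univ_pi hs)]
  -- The old coordinate `i` is forgotten, so its side of the box becomes the whole space.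
  have hpre : (fun p : (ι → X) × X => Function.update p.1 i p.2) ⁻¹' Set.univ.pi s
      = (Set.univ.pi (Function.update s i Set.univ)) ×ˢ s i := by
    ext ⟨y, t⟩
    simp only [Set.mem_preimage, Set.mem_univ_pi, Set.mem_prod]
    constructor
    · intro h
      refine ⟨fun j => ?_, by simpa using h i⟩
      by_cases hj : j = i
      · subst hj; simp
      · simpa [hj] using h j
    · rintro ⟨h, ht⟩ j
      by_cases hj : j = i
      · subst hj; simpa using ht
      · simpa [hj] using h j
  rw [hpre, Measure.prod_prod, Measure.pi_pi, ← Finset.mul_prod_erase _ _ (Finset.mem_univ i),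
    ← Finset.mul_prod_erase (Finset.univ) (fun j => μ' j (s j)) (Finset.mem_univ i)]
  rw [Function.update_self, measure_univ, one_mul, mul_comm]
  congr 1
  refine Finset.prod_congr rfl fun j hj => ?_
  rw [Function.update_of_ne (Finset.ne_of_mem_erase hj), h j (Finset.ne_of_mem_erase hj)]

/-- The pointwise bound holds for unrelated `t` and `t'`, so each may be averaged over its own law.
-/
theorem lintegral_le_mul_lintegral_of_forall_le {X : Type*} [MeasurableSpace X]
    (μ μ' : Measure X) [IsProbabilityMeasure μ] [IsProbabilityMeasure μ']
    {f : X → ENNReal} (hf : Measurable f) {c : ENNReal} (h : ∀ t t', f t ≤ c * f t') :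
    ∫⁻ t, f t ∂μ ≤ c * ∫⁻ t, f t ∂μ' := by
  have h1 : ∀ t, f t ≤ c * ∫⁻ t', f t' ∂μ' := fun t => by
    rw [← lintegral_const_mul c hf]
    calc f t = ∫⁻ _, f t ∂μ' := by simp
      _ ≤ _ := lintegral_mono fun t' => h t t'
  calc ∫⁻ t, f t ∂μ ≤ ∫⁻ _, c * ∫⁻ t', f t' ∂μ' ∂μ := lintegral_mono h1
    _ = _ := by simp

/-- Differential privacy is inherited by independently randomized inputs. -/
theorem IsDP.bind_pi_le {X : Type u} {Y : Type v} [MeasurableSpace X] [MeasurableSpace Y] {m : ℕ}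
    {ε : ℝ} {κ : Kernel (Fin m → X) Y} (hκ : IsDP ε κ) (μ μ' : Fin m → Measure X)
    [∀ j, IsProbabilityMeasure (μ j)] [∀ j, IsProbabilityMeasure (μ' j)]
    (h : ∃ i, ∀ j, j ≠ i → μ j = μ' j) (S : Set Y) (hS : MeasurableSet S) :
    (Measure.pi μ).bind κ S ≤ ENNReal.ofReal (exp ε) * (Measure.pi μ').bind κ S := by
  obtain ⟨i, hi⟩ := h
  have hm : Measurable fun p : (Fin m → X) × X => Function.update p.1 i p.2 := measurable_update'
  have hκS : Measurable fun y => κ y S := κ.measurable_coe hS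
  have hκu : Measurable fun p : (Fin m → X) × X => κ (Function.update p.1 i p.2) S := hκS.comp hm
  rw [Measure.bind_apply hS κ.measurable.aemeasurable,
    Measure.bind_apply hS κ.measurable.aemeasurable,
    pi_eq_map_update μ μ' i hi]
  -- Resampling from the same law puts both sides over `Measure.pi μ`; only the law of the new
  -- coordinate `i` differs.
  conv_lhs => rw [pi_eq_map_update μ μ i fun _ _ => rfl]
  rw [lintegral_map hκS hm, lintegral_map hκS hm,
    lintegral_prod _ hκu.aemeasurable, lintegral_prod _ hκu.aemeasurable,
    ← lintegral_const_mul _ hκu.lintegral_prod_right']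
  refine lintegral_mono fun y => ?_
  refine lintegral_le_mul_lintegral_of_forall_le _ _
    (hκu.comp measurable_prodMk_left) fun t t' => ?_
  exact hκ _ _ ⟨i, fun j hj => by simp [hj]⟩ S hS

/-! ### Generalization of private maps -/

section Swap

variable {X : Type u} {W : Type v} [MeasurableSpace X] [MeasurableSpace W]

/-- With `a`, `b` the two integrals, `b ≥ exp (-ε) * a`, hence `a - b ≤ (1 - exp (-ε)) * a`, and `a
≤ 1`. -/
theorem integral_sub_le_of_measure_le (μ μ' : Measure W) [IsProbabilityMeasure μ]
    [IsProbabilityMeasure μ'] {ε : ℝ}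
    (h : ∀ S, MeasurableSet S → μ S ≤ ENNReal.ofReal (exp ε) * μ' S)
    {f : W → ℝ} (hf : Measurable f) (hf01 : ∀ w, f w ∈ Set.Icc (0 : ℝ) 1) :
    ∫ w, f w ∂μ - ∫ w, f w ∂μ' ≤ 1 - exp (-ε) := by
  have hle : μ ≤ ENNReal.ofReal (exp ε) • μ' := Measure.le_iff.2 fun S hS => h S hS
  have hi : ∀ (ρ : Measure W) [IsProbabilityMeasure ρ], Integrable f ρ := fun ρ _ =>
    Integrable.of_mem_Icc 0 1 hf.aemeasurable (ae_of_all _ hf01)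
  have h1 : ∫ w, f w ∂μ ≤ exp ε * ∫ w, f w ∂μ' := by
    have := integral_mono_measure hle (ae_of_all _ fun w => (hf01 w).1)
      ((hi μ').smul_measure ENNReal.ofReal_ne_top)
    rwa [integral_smul_measure, ENNReal.toReal_ofReal (exp_pos ε).le, smul_eq_mul] at this
  have h2 : ∫ w, f w ∂μ ≤ 1 :=
    ((convex_Icc (0 : ℝ) 1).integral_mem isClosed_Icc (ae_of_all _ hf01) (hi μ)).2
  have hε : 0 ≤ ε := by
    have := h Set.univ MeasurableSet.univ
    simpa using this
  have h3 : exp (-ε) * ∫ w, f w ∂μ ≤ ∫ w, f w ∂μ' := by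
    calc exp (-ε) * ∫ w, f w ∂μ ≤ exp (-ε) * (exp ε * ∫ w, f w ∂μ') := by gcongr
      _ = _ := by rw [← mul_assoc, ← exp_add]; simp
  have h4 : exp (-ε) ≤ 1 := by simpa using hε
  nlinarith

/-- The generalization gap of a differentially private map of an i.i.d. sample. -/
theorem integral_gap_le {m : ℕ} (hm : m ≠ 0) (ν : Measure X) [IsProbabilityMeasure ν] {ε : ℝ}
    (F : Kernel (Fin m → X) W) [IsMarkovKernel F] (hF : IsDP ε F) (g : W → X → ℝ)
    (hg : Measurable (Function.uncurry g)) (hg01 : ∀ w x, g w x ∈ Set.Icc (0 : ℝ) 1) :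
    ∫ x, ∫ w, (∫ y, g w y ∂ν - 1 / (m : ℝ) * ∑ i, g w (x i)) ∂(F x)
      ∂(Measure.pi fun _ : Fin m => ν) ≤ 1 - exp (-ε) := by
  have hgx : ∀ y, Measurable fun w => g w y := fun y => hg.comp measurable_prodMk_right
  have hgw : ∀ w, Measurable fun y => g w y := fun w => hg.comp measurable_prodMk_left
  -- Expected loss at a test point after training on a sample: a fresh point gives the population
  -- risk, `x i` the empirical one.
  let Φ : (Fin m → X) × X → ℝ := fun p => ∫ w, g w p.2 ∂(F p.1)
  have hΦm : Measurable Φ := by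
    have : StronglyMeasurable fun p : (Fin m → X) × X => ∫ w, g w p.2 ∂(F.prodMkRight X p) :=
      StronglyMeasurable.integral_kernel_prod_right (f := fun (p : (Fin m → X) × X) w => g w p.2)
        (hg.comp (measurable_snd.prodMk (measurable_snd.comp measurable_fst))).stronglyMeasurable
    simpa using this.measurable
  have hgint : ∀ x y, Integrable (fun w => g w y) (F x) := fun x y =>
    Integrable.of_mem_Icc 0 1 (hgx y).aemeasurable (ae_of_all _ fun w => hg01 w y)
  have hΦ01 : ∀ p, Φ p ∈ Set.Icc (0 : ℝ) 1 := fun p =>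
    (convex_Icc (0 : ℝ) 1).integral_mem isClosed_Icc (ae_of_all _ fun w => hg01 w _) (hgint _ _)
  have hpop : Measurable fun w => ∫ y, g w y ∂ν :=
    (hg.stronglyMeasurable.integral_prod_right).measurable
  have hpopint : ∀ x, Integrable (fun w => ∫ y, g w y ∂ν) (F x) := fun x =>
    Integrable.of_mem_Icc 0 1 hpop.aemeasurable (ae_of_all _ fun w =>
      (convex_Icc (0 : ℝ) 1).integral_mem isClosed_Icc (ae_of_all _ fun y => hg01 w y)
        (Integrable.of_mem_Icc 0 1 (hgw w).aemeasurable (ae_of_all _ fun y => hg01 w y)))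
  have hΦint : Integrable Φ ((Measure.pi fun _ : Fin m => ν).prod ν) :=
    Integrable.of_mem_Icc 0 1 hΦm.aemeasurable (ae_of_all _ hΦ01)
  have hup : ∀ i, Measurable fun p : (Fin m → X) × X => Function.update p.1 i p.2 :=
    fun i => measurable_update'
  have hdiag : ∀ i, Measurable fun x : Fin m → X => Φ (x, x i) := fun i =>
    hΦm.comp (measurable_id.prodMk (measurable_pi_apply i))
  have hdiagint : ∀ i, Integrable (fun x => Φ (x, x i)) (Measure.pi fun _ : Fin m => ν) :=
    fun i => Integrable.of_mem_Icc 0 1 (hdiag i).aemeasurable (ae_of_all _ fun x => hΦ01 _)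
  have hinner : ∀ x, ∫ w, (∫ y, g w y ∂ν - 1 / (m : ℝ) * ∑ i, g w (x i)) ∂(F x)
      = ∫ y, Φ (x, y) ∂ν - 1 / (m : ℝ) * ∑ i, Φ (x, x i) := fun x => by
    rw [integral_sub (hpopint x)
      ((integrable_finsetSum _ fun i _ => hgint x (x i)).const_mul _),
      integral_const_mul, integral_finsetSum _ fun i _ => hgint x (x i)]
    congr 1
    refine integral_integral_swap (f := g) ?_
    exact Integrable.of_mem_Icc 0 1 hg.aemeasurable (ae_of_all _ fun p => hg01 p.1 p.2)
  -- Writing `x i` as a resampled point, both terms test at the same point, and their training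
  -- samples differ in entry `i` only.
  have hswap : ∀ i, ∫ p, Φ p ∂((Measure.pi fun _ : Fin m => ν).prod ν)
      - ∫ x, Φ (x, x i) ∂(Measure.pi fun _ : Fin m => ν) ≤ 1 - exp (-ε) := fun i => by
    have h1 : ∫ x, Φ (x, x i) ∂(Measure.pi fun _ : Fin m => ν)
        = ∫ p, Φ (Function.update p.1 i p.2, p.2) ∂((Measure.pi fun _ : Fin m => ν).prod ν) := by
      conv_lhs => rw [pi_eq_map_update (fun _ : Fin m => ν) (fun _ => ν) i fun _ _ => rfl]
      rw [integral_map (hup i).aemeasurable (hdiag i).aestronglyMeasurable]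
      simp
    have h2 : Integrable (fun p : (Fin m → X) × X => Φ (Function.update p.1 i p.2, p.2))
        ((Measure.pi fun _ : Fin m => ν).prod ν) :=
      Integrable.of_mem_Icc 0 1 (hΦm.comp ((hup i).prodMk measurable_snd)).aemeasurable
        (ae_of_all _ fun p => hΦ01 _)
    rw [h1, ← integral_sub hΦint h2]
    calc _ ≤ ∫ _, (1 - exp (-ε)) ∂((Measure.pi fun _ : Fin m => ν).prod ν) := by
          refine integral_mono (hΦint.sub h2) (integrable_const _) fun p => ?_
          exact integral_sub_le_of_measure_le _ _
            (hF _ _ ⟨i, fun j hj => by simp [hj]⟩) (hgx _) fun w => hg01 w _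
      _ = _ := by simp
  simp_rw [hinner]
  rw [integral_sub hΦint.integral_prod_left
      ((integrable_finsetSum _ fun i _ => hdiagint i).const_mul _),
    integral_const_mul, integral_finsetSum _ fun i _ => hdiagint i, ← integral_prod _ hΦint]
  have hm' : (0 : ℝ) < m := by positivity
  have hsum := Finset.sum_le_sum fun i (_ : i ∈ Finset.univ) => hswap i
  simp only [Finset.sum_sub_distrib, Finset.sum_const, Finset.card_univ, Fintype.card_fin,
    nsmul_eq_mul] at hsum
  rw [← mul_le_mul_iff_right₀ hm', mul_sub, ← mul_assoc, mul_one_div_cancel hm'.ne', one_mul,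
    mul_sub]
  linarith

end Swap

/-- With `t = 1 - exp (-ε)`, both `t ≤ 1` and `t ≤ ε ≤ exp ε - 1`, so `t ^ 2` is below both entries
of the minimum. -/
theorem one_sub_exp_neg_le (ε : ℝ) (hε : 0 ≤ ε) :
    1 - exp (-ε) ≤ 2 * √(min ε (ε * (exp ε - 1))) := by
  have h1 : 1 - exp (-ε) ≤ ε := by linarith [add_one_le_exp (-ε)]
  have h2 : 1 - exp (-ε) ≤ 1 := by linarith [exp_pos (-ε)]
  have h0 : 0 ≤ 1 - exp (-ε) := by simpa using hε
  have h3 : ε ≤ exp ε - 1 := by linarith [add_one_le_exp ε]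
  have : 1 - exp (-ε) ≤ √(min ε (ε * (exp ε - 1))) :=
    le_sqrt_of_sq_le (le_min (by nlinarith) (by nlinarith))
  linarith [sqrt_nonneg (min ε (ε * (exp ε - 1)))]

/-! ### Counting and averaging over leaves -/

section Leaves

variable {Z : Type u} [MeasurableSpace Z] (n : ℕ → ℕ)

/-- The number of leaves of a subtree of height `h` whose root has depth `d`. -/
def leafCount (d h : ℕ) : ℕ := ∏ i ∈ Finset.range h, n (d + 1 + i)

theorem leafCount_succ (d h : ℕ) : leafCount n d (h + 1) = n (d + 1) * leafCount n (d + 1) h := by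
  rw [leafCount, Finset.prod_range_succ', mul_comm, leafCount]
  refine congrArg₂ _ rfl (Finset.prod_congr rfl fun i _ => ?_)
  congr 1; ring

theorem prod_Icc_eq_leafCount (L : ℕ) :
    ∏ l ∈ Finset.Icc 1 L, (n l : ℝ) = (leafCount n 0 L : ℝ) := by
  induction L with
  | zero => simp [leafCount]
  | succ L ih =>
    rw [Finset.prod_Icc_succ_top (by omega), ih, leafCount, leafCount, Finset.prod_range_succ]
    push_cast
    simp [add_comm]

theorem measurable_leafSum {W : Type v} [MeasurableSpace W] {ℓ : W → Z → ℝ}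
    (hℓ : Measurable (Function.uncurry ℓ)) (h : ℕ) : ∀ d : ℕ,
    Measurable fun p : W × Leaves Z n d h => leafSum (ℓ p.1) d h p.2 := by
  induction h with
  | zero => exact fun d => hℓ
  | succ h ih =>
    intro d
    change Measurable fun p : W × (Fin (n (d + 1)) → Leaves Z n (d + 1) h) =>
      ∑ i, leafSum (ℓ p.1) (d + 1) h (p.2 i)
    exact Finset.measurable_sum _ fun i _ => (ih (d + 1)).comp
      (measurable_fst.prodMk ((measurable_pi_apply i).comp measurable_snd))

end Leaves

theorem leafSum_mem_Icc {Z : Type u} {n : ℕ → ℕ} {f : Z → ℝ} (hf : ∀ z, f z ∈ Set.Icc (0 : ℝ) 1) (h : ℕ) :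
    ∀ (d : ℕ) (x : Leaves Z n d h), leafSum f d h x ∈ Set.Icc (0 : ℝ) (leafCount n d h) := by
  induction h with
  | zero => exact fun d x => by simpa [leafCount, leafSum] using hf x
  | succ h ih =>
    intro d x
    refine ⟨Finset.sum_nonneg fun i _ => (ih (d + 1) (x i)).1, ?_⟩
    calc leafSum f d (h + 1) x
        ≤ ∑ _ : Fin (n (d + 1)), (leafCount n (d + 1) h : ℝ) :=
          Finset.sum_le_sum fun i _ => (ih (d + 1) (x i)).2
      _ = _ := by rw [leafCount_succ]; simp

theorem integral_measure_bind {X Y : Type*} [MeasurableSpace X] [MeasurableSpace Y]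
    {μ : Measure X} [SFinite μ] {κ : Kernel X Y} [IsSFiniteKernel κ] {f : Y → ℝ}
    (hf : Integrable f (μ.bind κ)) :
    ∫ y, f y ∂(μ.bind κ) = ∫ x, ∫ y, f y ∂(κ x) ∂μ := by
  rw [Measure.comp_eq_comp_const_apply] at hf ⊢
  rw [Kernel.integral_comp hf, Kernel.const_apply]

theorem measurable_leafSum_right {Z : Type u} [MeasurableSpace Z] (n : ℕ → ℕ) {f : Z → ℝ}
    (hf : Measurable f) (d h : ℕ) : Measurable (leafSum (n := n) f d h) :=
  (measurable_leafSum (W := Unit) (ℓ := fun _ => f) n (hf.comp measurable_snd) h d).comp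
    (measurable_const (a := ()) |>.prodMk measurable_id)

/-- The mean over one child's block. Taking `ih` as an argument lets it serve inside the induction
below as well as after it. -/
theorem integral_leafSum_bind {Z : Type u} [MeasurableSpace Z] (n : ℕ → ℕ) {f : Z → ℝ}
    (hf : Measurable f) (hf01 : ∀ z, f z ∈ Set.Icc (0 : ℝ) 1) (h d : ℕ)
    (ih : ∀ ν : NodeSpace Z h,
      ∫ x, leafSum f d h x ∂(leafLaw n d h ν) = leafCount n d h * ∫ z, f z ∂(testLaw h ν))
    (μ : NodeSpace Z (h + 1)) :
    ∫ x, leafSum f d h x ∂((μ.toProb : Measure (NodeSpace Z h)).bind (leafLaw n d h))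
      = leafCount n d h * ∫ z, f z ∂(testLaw (h + 1) μ) := by
  let κ : Kernel (NodeSpace Z h) (Leaves Z n d h) :=
    ⟨leafLaw n d h, (measurable_leafLaw n h d).1⟩
  let τ : Kernel (NodeSpace Z h) Z := ⟨testLaw h, (measurable_testLaw h).1⟩
  have : IsMarkovKernel κ := ⟨(measurable_leafLaw n h d).2⟩
  have : IsMarkovKernel τ := ⟨(measurable_testLaw h).2⟩
  let P : Measure (NodeSpace Z h) := μ.toProb
  have hP : IsProbabilityMeasure P := μ.toProb.2
  have hint : Integrable (fun x => leafSum f d h x) (P.bind κ) :=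
    Integrable.of_mem_Icc _ _ (measurable_leafSum_right n hf d h).aemeasurable
      (ae_of_all _ fun x => leafSum_mem_Icc hf01 h d x)
  have hint' : Integrable f (P.bind τ) :=
    Integrable.of_mem_Icc 0 1 hf.aemeasurable (ae_of_all _ hf01)
  change ∫ x, leafSum f d h x ∂(P.bind κ) = leafCount n d h * ∫ z, f z ∂(P.bind τ)
  rw [integral_measure_bind hint, integral_measure_bind hint', ← integral_const_mul]
  exact integral_congr_ae (ae_of_all _ ih)

/-- Linearity of expectation: each leaf has the test law as marginal, however the leaves depend on
each other. -/
theorem integral_leafSum {Z : Type u} [MeasurableSpace Z] (n : ℕ → ℕ) {f : Z → ℝ}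
    (hf : Measurable f) (hf01 : ∀ z, f z ∈ Set.Icc (0 : ℝ) 1) (h : ℕ) :
    ∀ (d : ℕ) (μ : NodeSpace Z h),
      ∫ x, leafSum f d h x ∂(leafLaw n d h μ) = leafCount n d h * ∫ z, f z ∂(testLaw h μ) := by
  induction h with
  | zero =>
    intro d μ
    have h1 : ∫ x, leafSum f d 0 x ∂(leafLaw n d 0 μ) = f μ :=
      integral_dirac' (α := Z) (fun z => f z) μ hf.stronglyMeasurable
    have h2 : ∫ z, f z ∂(testLaw 0 μ) = f μ :=
      integral_dirac' (α := Z) (fun z => f z) μ hf.stronglyMeasurable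
    rw [h1, h2]
    simp [leafCount]
  | succ h ih =>
    intro d μ
    let ν : Measure (Leaves Z n (d + 1) h) :=
      (μ.toProb : Measure (NodeSpace Z h)).bind (leafLaw n (d + 1) h)
    have hP : IsProbabilityMeasure (μ.toProb : Measure (NodeSpace Z h)) := μ.toProb.2
    have hν : IsProbabilityMeasure ν := isProbabilityMeasure_bind
      (measurable_leafLaw n h _).1.aemeasurable (ae_of_all _ (measurable_leafLaw n h _).2)
    have hint : Integrable (fun x => leafSum f (d + 1) h x) ν :=
      Integrable.of_mem_Icc _ _ (measurable_leafSum_right n hf _ h).aemeasurable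
        (ae_of_all _ fun x => leafSum_mem_Icc hf01 h (d + 1) x)
    calc ∫ x, leafSum f d (h + 1) x ∂(leafLaw n d (h + 1) μ)
        = ∫ x : Fin (n (d + 1)) → Leaves Z n (d + 1) h, ∑ i, leafSum f (d + 1) h (x i)
            ∂(Measure.pi fun _ => ν) := rfl
      _ = ∑ i : Fin (n (d + 1)), ∫ x, leafSum f (d + 1) h x ∂ν := by
        rw [integral_finsetSum _ fun i _ => integrable_comp_eval (μ := fun _ => ν) hint]
        exact Finset.sum_congr rfl fun i _ =>
          integral_comp_eval (μ := fun _ => ν) hint.aestronglyMeasurable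
      _ = n (d + 1) * (leafCount n (d + 1) h * ∫ z, f z ∂(testLaw (h + 1) μ)) := by
        rw [integral_leafSum_bind n hf hf01 h (d + 1) (ih (d + 1)) μ]; simp
      _ = _ := by rw [leafCount_succ, Nat.cast_mul, mul_assoc]

/-! ### The algorithm as a private map of blocks -/

/-- The law of the output of the root, as a kernel of the families of leaves below its
children. -/
noncomputable def Aggregation.outKernel {Z : Type u} {W : Type v} [MeasurableSpace Z]
    [MeasurableSpace W] {n : ℕ → ℕ} {d h : ℕ} (A : Aggregation Z W n d (h + 1)) :
    Kernel (Fin (n (d + 1)) → Leaves Z n (d + 1) h) W :=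
  ⟨A.outLaw, A.measurable_outLaw.1⟩

instance Aggregation.isMarkovKernel_outKernel {Z : Type u} {W : Type v} [MeasurableSpace Z]
    [MeasurableSpace W] {n : ℕ → ℕ} {d h : ℕ} (A : Aggregation Z W n d (h + 1)) :
    IsMarkovKernel A.outKernel :=
  ⟨A.measurable_outLaw.2⟩

/-- A private root step makes the whole algorithm private with respect to the replacement of all
the leaves below one child of the root. -/
theorem Aggregation.IsPrivate.isDP_outKernel {Z : Type u} {W : Type v} [MeasurableSpace Z]
    [MeasurableSpace W] {n : ℕ → ℕ} {d h : ℕ} {ε : ℕ → ℝ} {A : Aggregation Z W n d (h + 1)}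
    (hA : A.IsPrivate ε) : IsDP (ε (d + 1)) A.outKernel := by
  cases A with
  | last d κ hκ => exact hA
  | node d h κ hκ children =>
    rintro x x' ⟨i, hi⟩ S hS
    have := fun j y => (children j).measurable_outLaw.2 y
    exact hA.1.bind_pi_le (fun j => (children j).outLaw (x j))
      (fun j => (children j).outLaw (x' j)) ⟨i, fun j hj => by rw [hi j hj]⟩ S hS

end HierFL

theorem mainTheorem3 {Z : Type u} {W : Type v} [MeasurableSpace Z] [MeasurableSpace W]
    (L : ℕ) (n : ℕ → ℕ) (hn : ∀ l ∈ Finset.Icc 1 L, 1 ≤ n l)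
    (D : HierFL.NodeSpace Z L)
    (ℓ : W → Z → ℝ) (hℓ : Measurable (Function.uncurry ℓ))
    (hℓ01 : ∀ w z, ℓ w z ∈ Set.Icc (0 : ℝ) 1)
    (A : HierFL.Aggregation Z W n 0 L)
    (ε : ℕ → ℝ) (hA : A.IsPrivate ε) :
    HierFL.gen ℓ D A ≤
      2 * ∑ l ∈ Finset.Icc 1 L, √(min (ε l) (ε l * (exp (ε l) - 1))) := by
  open HierFL in
  obtain _ | h := L
  -- No aggregation tree has height `0`.
  · cases A
  have hDP : IsDP (ε 1) A.outKernel := hA.isDP_outKernel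
  let P : Measure (NodeSpace Z h) := D.toProb
  have hP : IsProbabilityMeasure P := D.toProb.2
  let ν : Measure (Leaves Z n 1 h) := P.bind (leafLaw n 1 h)
  have hν : IsProbabilityMeasure ν := isProbabilityMeasure_bind
    (measurable_leafLaw n h 1).1.aemeasurable (ae_of_all _ (measurable_leafLaw n h 1).2)
  have hn1 : n 1 ≠ 0 := Nat.one_le_iff_ne_zero.1 (hn 1 (by simp))
  have hN : 0 < leafCount n 1 h := Finset.prod_pos fun i hi =>
    hn (1 + 1 + i) (by simp at hi ⊢; omega)
  have hN' : (0 : ℝ) < leafCount n 1 h := by exact_mod_cast hN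
  let g : W → Leaves Z n 1 h → ℝ := fun w x => leafSum (ℓ w) 1 h x / leafCount n 1 h
  have hg : Measurable (Function.uncurry g) := (measurable_leafSum n hℓ h 1).div_const _
  have hg01 : ∀ w x, g w x ∈ Set.Icc (0 : ℝ) 1 := fun w x => by
    have := leafSum_mem_Icc (hℓ01 w) h 1 x
    exact ⟨div_nonneg this.1 hN'.le, (div_le_one hN').2 this.2⟩
  have hpop : ∀ w, popRisk ℓ D w = ∫ y, g w y ∂ν := fun w => by
    have hw : Measurable (ℓ w) := hℓ.comp measurable_prodMk_left
    have hsum : ∫ y, leafSum (ℓ w) 1 h y ∂ν = leafCount n 1 h * popRisk ℓ D w :=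
      integral_leafSum_bind n hw (hℓ01 w) h 1 (integral_leafSum n hw (hℓ01 w) h 1) D
    rw [integral_div, hsum, mul_div_cancel_left₀ _ hN'.ne']
  have hemp : ∀ w (x : Fin (n 1) → Leaves Z n 1 h),
      empRisk ℓ w (L := h + 1) (n := n) x = 1 / (n 1 : ℝ) * ∑ i, g w (x i) := fun w x => by
    have : leafSum (ℓ w) 0 (h + 1) (n := n) x = ∑ i, leafSum (ℓ w) 1 h (x i) := rfl
    unfold empRisk
    rw [prod_Icc_eq_leafCount, leafCount_succ, this, ← Finset.sum_div]
    push_cast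
    field_simp
  have hgap := integral_gap_le hn1 ν A.outKernel hDP g hg hg01
  have hgen : gen ℓ D A = ∫ x, ∫ w, (∫ y, g w y ∂ν - 1 / (n 1 : ℝ) * ∑ i, g w (x i))
      ∂(A.outKernel x) ∂(Measure.pi fun _ : Fin (n 1) => ν) := by
    simp_rw [← hpop, ← hemp]
    rfl
  -- Privacy forces `0 ≤ ε 1` only if some input exists; a probability measure on the inputs
  -- provides one.
  have hne : Nonempty (Fin (n 1) → Leaves Z n 1 h) :=
    (Measure.pi fun _ : Fin (n 1) => ν).nonempty_of_neZero
  have hε : 0 ≤ ε 1 := by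
    obtain ⟨x⟩ := hne
    simpa using hDP x x ⟨⟨0, Nat.pos_of_ne_zero hn1⟩, fun _ _ => rfl⟩ Set.univ MeasurableSet.univ
  rw [hgen]
  refine (hgap.trans (one_sub_exp_neg_le _ hε)).trans ?_
  gcongr
  exact Finset.single_le_sum (f := fun l => √(min (ε l) (ε l * (exp (ε l) - 1))))
    (fun l _ => sqrt_nonneg _) (by simp)
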